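/- Tile $\mathbb{R}^2$ by unit squares with sides parallel to the axes and centres at the points of $\mathbb{Z}^2$; let $S_0$ be the square centred at the origin. Every square is either occupied or vacant, and $S_0$ is occupied. Two distinct squares are plus adjacent if they share an edge. Let $C^+(0)$ be the set of all occupied squares that can be joined to $S_0$ by a finite sequence of distinct occupied squares in which consecutive squares are plus adjacent. Let $G_0^+$ be the graph whose vertices and edges are the corners and the edges of the squares of $C^+(0)$. A cycle in $G_0^+$ is a closed path without repeated vertices, identified with its set of edges. Such a cycle $C$ divides the plane into a bounded region, the interior of $C$, and an unbounded region, the exterior of $C$; a square lies in one of these regions if its topological interior (the open square) does, and an edge not in $C$ belongs to the exterior of $C$ if both squares having it as an edge lie in the exterior of $C$. The outermost boundary $\partial_0^+$ of $C^+(0)$ is the set of all edges $e$ of $G_0^+$ such that, for every cycle $C$ in $G_0^+$, either $e$ is an edge of $C$ or $e$ belongs to the exterior of $C$. Theorem. Suppose that $C^+(0)$ is finite. Then $\partial_0^+$ is (the edge set of) a cycle in $G_0^+$, and it is the unique cycle $D$ in $G_0^+$ with the following two properties: (i) all squares of $C^+(0)$ are contained in the interior of $D$; (ii) every edge of $D$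 is an edge of an occupied square of $C^+(0)$ contained in the interior of $D$, and also an edge of a vacant square lying in the exterior of $D$. -/

import Mathlib

namespace SquareTiling

/-- A unit square of the tiling of the plane, named by its centre, a point of `ℤ × ℤ`;
the square `(0, 0)` is centred at the origin. -/
abbrev Square := ℤ × ℤ

/-- A corner of the squares of the tiling. The corner `(i, j)` is the lower left corner of the
square centred at `(i, j)`. -/
abbrev Corner := ℤ × ℤ

/-- The point of the plane at which a corner lies. -/
noncomputable def cornerPoint (v : Corner) : ℝ × ℝ := ((v.1 : ℝ) - 1 / 2, (v.2 : ℝ) - 1 / 2)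

/-- The open unit square with centre `z`. -/
def openSquare (z : Square) : Set (ℝ × ℝ) :=
  {p | |p.1 - (z.1 : ℝ)| < 1 / 2 ∧ |p.2 - (z.2 : ℝ)| < 1 / 2}

/-- The four edges of the square `z`: bottom, right, top, left. -/
def squareEdges (z : Square) : Set (Sym2 Corner) :=
  {s((z.1, z.2), (z.1 + 1, z.2)), s((z.1 + 1, z.2), (z.1 + 1, z.2 + 1)),
    s((z.1, z.2 + 1), (z.1 + 1, z.2 + 1)), s((z.1, z.2), (z.1, z.2 + 1))}

/-- Plus adjacency: two different squares that share an edge. -/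
def plusGraph : SimpleGraph Square where
  Adj z w := z ≠ w ∧ (squareEdges z ∩ squareEdges w).Nonempty
  symm := ⟨fun z w h => ⟨h.1.symm, by rw [Set.inter_comm]; exact h.2⟩⟩
  loopless := ⟨fun _ h => h.1 rfl⟩

/-- The plus connected occupied component of the origin, where `occ` is the set of occupied
squares (all others are vacant): the squares joined to the square `(0, 0)` by a plus connected
path of distinct occupied squares. -/
def plusComponent (occ : Set Square) : Set Square :=
  {z | ∃ p : plusGraph.Walk (0, 0) z, p.IsPath ∧ ∀ y ∈ p.support, y ∈ occ}

/-- The graph formed by the corners and the edges of the squares of `K`. (The elements of `Corner`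
that are not corners of squares of `K` are isolated, so they lie on no edge and on no cycle.) -/
def edgeGraph (K : Set Square) : SimpleGraph Corner :=
  SimpleGraph.fromEdgeSet {e | ∃ z ∈ K, e ∈ squareEdges z}

/-- `C` is the set of edges of a (self avoiding) cycle of the graph `H`. -/
def IsCycleIn (H : SimpleGraph Corner) (C : Set (Sym2 Corner)) : Prop :=
  ∃ (v : Corner) (p : H.Walk v v), p.IsCycle ∧ C = {e | e ∈ p.edges}

/-- The subset of the plane covered by a set of edges. -/
def carrier (C : Set (Sym2 Corner)) : Set (ℝ × ℝ) :=
  {x | ∃ u v : Corner, s(u, v) ∈ C ∧ x ∈ segment ℝ (cornerPoint u) (cornerPoint v)}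

/-- The interior of a cycle: the points of its complement in the plane whose connected component
in this complement is bounded. -/
def cycleInterior (C : Set (Sym2 Corner)) : Set (ℝ × ℝ) :=
  {x | x ∉ carrier C ∧ Bornology.IsBounded (connectedComponentIn (carrier C)ᶜ x)}

/-- The exterior of a cycle: the points of its complement in the plane whose connected component
in this complement is unbounded. -/
def cycleExterior (C : Set (Sym2 Corner)) : Set (ℝ × ℝ) :=
  {x | x ∉ carrier C ∧ ¬ Bornology.IsBounded (connectedComponentIn (carrier C)ᶜ x)}

/-- The edge `e` belongs to the exterior of the cycle `C`: the (two) squares that have `e` as an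
edge lie in the exterior of `C`. -/
def EdgeInExterior (e : Sym2 Corner) (C : Set (Sym2 Corner)) : Prop :=
  ∀ z : Square, e ∈ squareEdges z → openSquare z ⊆ cycleExterior C

/-- The outermost boundary of `K`: the edges `e` of its graph such that for every cycle `C` of this
graph, `e` is an edge of `C` or belongs to the exterior of `C`. -/
def outermostBoundary (K : Set Square) : Set (Sym2 Corner) :=
  {e | e ∈ (edgeGraph K).edgeSet ∧
    ∀ C : Set (Sym2 Corner), IsCycleIn (edgeGraph K) C → e ∈ C ∨ EdgeInExterior e C}

/-- All squares of `K` are contained in the interior of the cycle `C`. -/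
def ContainsSquares (K : Set Square) (C : Set (Sym2 Corner)) : Prop :=
  ∀ z ∈ K, openSquare z ⊆ cycleInterior C

/-- Every edge of the cycle `C` is an edge of an (occupied) square of `K` that is contained in the
interior of `C`, and also an edge of a vacant square that lies in the exterior of `C`. -/
def SeparatesOccupiedVacant (occ K : Set Square) (C : Set (Sym2 Corner)) : Prop :=
  ∀ e ∈ C,
    (∃ z : Square, e ∈ squareEdges z ∧ z ∈ K ∧ openSquare z ⊆ cycleInterior C) ∧
    (∃ w : Square, e ∈ squareEdges w ∧ w ∉ occ ∧ openSquare w ⊆ cycleExterior C)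

end SquareTiling

/-! The Jordan curve theorem is avoided. Let K be the component of the origin. Call a square outer
if infinitely many squares can be reached from it without crossing an edge of K, and let
`outerBoundary` consist of the edges between outer and non-outer squares. As K is finite, only
finitely many squares are not outer, and any two outer squares reach one another without crossing
edges of K. A non-outer square that shares an edge with an outer one lies in K.

Around a corner the four squares alternate between outer and non-outer an even number of times. So
the outer boundary, finite and nonempty, has no leaf and contains a cycle C. Crossing parity
two-colours the squares so that the colour changes exactly across C (`exists_colouring`). The
squares of K are joined without crossing the outer boundary, the outer squares without crossing
edges of K, so each of these two classes has one colour. The two colours differ, as one edge of C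
shows, hence every edge of the outer boundary lies in C (`eq_outerBoundary_of_subset`). The same
lemma gives uniqueness, because (i) and (ii) put a cycle inside the outer boundary.

Topology enters only in showing that a square is interior or exterior to C according to whether
finitely or infinitely many squares can be reached from it without crossing C. -/

namespace SquareTiling

/-! ### Edges of the tiling and the squares that have them -/

/-- The horizontal edge with left end `v`. -/
def hEdge (v : Corner) : Sym2 Corner := s(v, (v.1 + 1, v.2))

/-- The vertical edge with lower end `v`. -/
def vEdge (v : Corner) : Sym2 Corner := s(v, (v.1, v.2 + 1))

theorem hEdge_inj {v w : Corner} : hEdge v = hEdge w ↔ v = w := by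
  obtain ⟨a, b⟩ := v
  obtain ⟨c, d⟩ := w
  simp only [hEdge, Sym2.eq_iff, Prod.mk.injEq]
  omega

theorem vEdge_inj {v w : Corner} : vEdge v = vEdge w ↔ v = w := by
  obtain ⟨a, b⟩ := v
  obtain ⟨c, d⟩ := w
  simp only [vEdge, Sym2.eq_iff, Prod.mk.injEq]
  omega

theorem hEdge_ne_vEdge (v w : Corner) : hEdge v ≠ vEdge w := by
  obtain ⟨a, b⟩ := v
  obtain ⟨c, d⟩ := w
  simp only [hEdge, vEdge, ne_eq, Sym2.eq_iff, Prod.mk.injEq]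
  omega

theorem vEdge_ne_hEdge (v w : Corner) : vEdge v ≠ hEdge w := (hEdge_ne_vEdge w v).symm

theorem mem_squareEdges {e : Sym2 Corner} {z : Square} :
    e ∈ squareEdges z ↔
      e = hEdge z ∨ e = vEdge (z.1 + 1, z.2) ∨ e = hEdge (z.1, z.2 + 1) ∨ e = vEdge z :=
  Iff.rfl

theorem hEdge_mem_squareEdges {v : Corner} {z : Square} :
    hEdge v ∈ squareEdges z ↔ z = v ∨ z = (v.1, v.2 - 1) := by
  obtain ⟨a, b⟩ := v
  obtain ⟨c, d⟩ := z
  simp only [mem_squareEdges, hEdge_inj, hEdge_ne_vEdge, Prod.mk.injEq, false_or, or_false]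
  omega

theorem vEdge_mem_squareEdges {v : Corner} {z : Square} :
    vEdge v ∈ squareEdges z ↔ z = v ∨ z = (v.1 - 1, v.2) := by
  obtain ⟨a, b⟩ := v
  obtain ⟨c, d⟩ := z
  simp only [mem_squareEdges, vEdge_inj, vEdge_ne_hEdge, Prod.mk.injEq, false_or]
  omega

theorem eq_hEdge_or_eq_vEdge {e : Sym2 Corner} {z : Square} (h : e ∈ squareEdges z) :
    ∃ v, e = hEdge v ∨ e = vEdge v := by
  rcases h with h | h | h | h
  exacts [⟨_, .inl h⟩, ⟨_, .inr h⟩, ⟨_, .inl h⟩, ⟨_, .inr h⟩]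

/-- An edge belongs to at most two squares. -/
theorem eq_or_eq_of_mem_squareEdges {e : Sym2 Corner} {a b c : Square} (ha : e ∈ squareEdges a)
    (hb : e ∈ squareEdges b) (hab : a ≠ b) (hc : e ∈ squareEdges c) : c = a ∨ c = b := by
  obtain ⟨v, rfl | rfl⟩ := eq_hEdge_or_eq_vEdge ha
  · rw [hEdge_mem_squareEdges] at *
    grind
  · rw [vEdge_mem_squareEdges] at *
    grind

theorem not_isDiag_of_mem_squareEdges {e : Sym2 Corner} {z : Square} (h : e ∈ squareEdges z) :
    ¬ e.IsDiag := by
  obtain ⟨v, rfl | rfl⟩ := eq_hEdge_or_eq_vEdge h <;>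
    simp [hEdge, vEdge, Prod.ext_iff]

/-- The edges of the squares of `K`. -/
def edgesOf (K : Set Square) : Set (Sym2 Corner) := {e | ∃ z ∈ K, e ∈ squareEdges z}

theorem edgeSet_edgeGraph (K : Set Square) : (edgeGraph K).edgeSet = edgesOf K := by
  rw [edgeGraph, SimpleGraph.edgeSet_fromEdgeSet]
  ext e
  exact ⟨fun h => h.1, fun h => ⟨h, fun hd => by
    obtain ⟨z, _, hz⟩ := h
    exact not_isDiag_of_mem_squareEdges hz hd⟩⟩

theorem IsCycleIn.subset_edgesOf {K : Set Square} {C : Set (Sym2 Corner)}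
    (h : IsCycleIn (edgeGraph K) C) : C ⊆ edgesOf K := by
  obtain ⟨v, p, -, rfl⟩ := h
  intro e he
  rw [← edgeSet_edgeGraph]
  exact p.edges_subset_edgeSet he

/-! ### Crossing parity and the two-colouring of the squares -/

section Parity

open Classical in
/-- The indicator of the vertical edges in the row of the square `z` to the right of its centre. -/
noncomputable def rightIndicator (z : Square) (e : Sym2 Corner) : ZMod 2 :=
  if ∃ i, z.1 < i ∧ e = vEdge (i, z.2) then 1 else 0

theorem rightIndicator_hEdge (z : Square) (v : Corner) : rightIndicator z (hEdge v) = 0 := by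
  simp [rightIndicator, hEdge_ne_vEdge]

theorem rightIndicator_vEdge (z : Square) (v : Corner) :
    rightIndicator z (vEdge v) = if z.1 < v.1 ∧ v.2 = z.2 then 1 else 0 := by
  rw [rightIndicator]
  congr 1
  simp only [vEdge_inj, eq_iff_iff]
  constructor
  · rintro ⟨i, hi, rfl⟩
    exact ⟨hi, rfl⟩
  · rintro ⟨h1, h2⟩
    exact ⟨v.1, h1, by rw [← h2]⟩

theorem rightIndicator_left {z : Square} {e : Sym2 Corner} (he : ∃ v, e = hEdge v ∨ e = vEdge v) :
    rightIndicator (z.1 - 1, z.2) e = rightIndicator z e + if e = vEdge z then 1 else 0 := by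
  obtain ⟨⟨a, b⟩, rfl | rfl⟩ := he
  · simp [rightIndicator_hEdge, hEdge_ne_vEdge]
  · obtain ⟨c, d⟩ := z
    simp only [rightIndicator_vEdge, vEdge_inj, Prod.mk.injEq]
    split_ifs <;> first | omega | simp

/-- The three terms on the left together mark the edges with exactly one end in the half line of
corners `(i, z.2)`, `i > z.1`. The right side therefore telescopes along a walk. -/
theorem rightIndicator_below {z : Square} {u v : Corner}
    (he : ∃ w, s(u, v) = hEdge w ∨ s(u, v) = vEdge w) :
    rightIndicator z s(u, v) + rightIndicator (z.1, z.2 - 1) s(u, v) +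
        (if s(u, v) = hEdge z then 1 else 0) =
      (if z.1 < u.1 ∧ u.2 = z.2 then 1 else 0) + (if z.1 < v.1 ∧ v.2 = z.2 then 1 else 0) := by
  obtain ⟨⟨a, b⟩, h | h⟩ := he
  · rw [h]
    simp only [rightIndicator_hEdge, hEdge_inj]
    obtain ⟨c, d⟩ := z
    rw [hEdge, Sym2.eq_iff] at h
    rcases h with ⟨rfl, rfl⟩ | ⟨rfl, rfl⟩ <;> simp only [Prod.mk.injEq] <;>
      split_ifs <;> first | contradiction | omega | rfl
  · rw [h]
    simp only [rightIndicator_vEdge, vEdge_ne_hEdge]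
    obtain ⟨c, d⟩ := z
    rw [vEdge, Sym2.eq_iff] at h
    rcases h with ⟨rfl, rfl⟩ | ⟨rfl, rfl⟩ <;> simp only [] <;>
      split_ifs <;> first | contradiction | omega | rfl

theorem sum_map_ite_eq_of_nodup {α : Type*} [DecidableEq α] {l : List α} (hl : l.Nodup) (a : α) :
    (l.map fun e => if e = a then (1 : ZMod 2) else 0).sum = if a ∈ l then 1 else 0 := by
  induction l with
  | nil => simp
  | cons b l ih =>
    rw [List.nodup_cons] at hl
    rw [List.map_cons, List.sum_cons, ih hl.2]
    by_cases h : b = a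
    · subst h
      simp [hl.1]
    · simp [h, Ne.symm h]

/-- For a closed trail along edges of the tiling, the squares can be two-coloured so that the
colour changes exactly across the edges of the trail. -/
theorem exists_colouring {K : Set Square} {C : Set (Sym2 Corner)}
    (hC : IsCycleIn (edgeGraph K) C) :
    ∃ f : Square → ZMod 2, ∀ a b e, a ≠ b → e ∈ squareEdges a → e ∈ squareEdges b →
      (f a ≠ f b ↔ e ∈ C) := by
  classical
  have hCK := hC.subset_edgesOf
  obtain ⟨v₀, p, hp, rfl⟩ := hC
  have hnd := hp.isTrail.edges_nodup
  have hlat : ∀ e ∈ p.edges, ∃ v, e = hEdge v ∨ e = vEdge v := fun e he => by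
    obtain ⟨z, _, hz⟩ := hCK he
    exact eq_hEdge_or_eq_vEdge hz
  -- The parity of the edges of the cycle met by the rightward ray from the centre of `z`.
  let f : Square → ZMod 2 := fun z => (p.edges.map (rightIndicator z)).sum
  have hleft : ∀ z : Square, f (z.1 - 1, z.2) = f z + if vEdge z ∈ p.edges then 1 else 0 := by
    intro z
    rw [← sum_map_ite_eq_of_nodup hnd, ← List.sum_map_add]
    exact congrArg List.sum (List.map_congr_left fun e he => rightIndicator_left (hlat e he))
  have hwalk : ∀ (z : Square) (u v : Corner) (q : (edgeGraph K).Walk u v),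
      (q.edges.map fun e => rightIndicator z e + rightIndicator (z.1, z.2 - 1) e +
        (if e = hEdge z then 1 else 0)).sum =
      (if z.1 < u.1 ∧ u.2 = z.2 then 1 else 0) + (if z.1 < v.1 ∧ v.2 = z.2 then 1 else 0) := by
    intro z u v q
    induction q with
    | nil => simp [CharTwo.add_self_eq_zero]
    | @cons u v w h q ih =>
      have hE : s(u, v) ∈ edgesOf K := by
        rw [← edgeSet_edgeGraph]
        exact h
      obtain ⟨y, _, hy⟩ := hE
      rw [SimpleGraph.Walk.edges_cons, List.map_cons, List.sum_cons, ih,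
        rightIndicator_below (eq_hEdge_or_eq_vEdge hy)]
      generalize (if z.1 < u.1 ∧ u.2 = z.2 then (1 : ZMod 2) else 0) = x1
      generalize (if z.1 < v.1 ∧ v.2 = z.2 then (1 : ZMod 2) else 0) = x2
      generalize (if z.1 < w.1 ∧ w.2 = z.2 then (1 : ZMod 2) else 0) = x3
      revert x1 x2 x3
      decide
  have hbelow : ∀ z : Square,
      f z + f (z.1, z.2 - 1) + (if hEdge z ∈ p.edges then 1 else 0) = 0 := by
    intro z
    rw [← sum_map_ite_eq_of_nodup hnd, ← List.sum_map_add, ← List.sum_map_add, hwalk,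
      CharTwo.add_self_eq_zero]
  have key1 : ∀ z : Square, (f z ≠ f (z.1 - 1, z.2) ↔ vEdge z ∈ p.edges) := by
    intro z
    rw [hleft z]
    by_cases h : vEdge z ∈ p.edges <;> simp [h]
  have key2 : ∀ z : Square, (f z ≠ f (z.1, z.2 - 1) ↔ hEdge z ∈ p.edges) := by
    intro z
    have := hbelow z
    revert this
    generalize f z = x
    generalize f (z.1, z.2 - 1) = y
    by_cases h : hEdge z ∈ p.edges <;> simp only [h, if_true, if_false] <;> revert x y <;> decide
  refine ⟨f, fun a b e hab ha hb => ?_⟩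
  obtain ⟨v, rfl | rfl⟩ := eq_hEdge_or_eq_vEdge ha
  · rw [hEdge_mem_squareEdges] at ha hb
    rcases ha with rfl | rfl <;> rcases hb with rfl | rfl
    · exact absurd rfl hab
    · exact key2 _
    · rw [ne_comm]
      exact key2 _
    · exact absurd rfl hab
  · rw [vEdge_mem_squareEdges] at ha hb
    rcases ha with rfl | rfl <;> rcases hb with rfl | rfl
    · exact absurd rfl hab
    · exact key1 _
    · rw [ne_comm]
      exact key1 _
    · exact absurd rfl hab

end Parity

/-- Without cycles, the start of a longest path has a neighbour other than the next vertex, and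
acyclicity puts it off the path, which could then be prolonged. -/
theorem exists_isCycle_of_no_leaf {V : Type*} {G : SimpleGraph V} (hfin : G.edgeSet.Finite)
    (hne : G.edgeSet.Nonempty) (hleaf : ∀ u v, G.Adj u v → ∃ w, w ≠ v ∧ G.Adj u w) :
    ∃ (v : V) (p : G.Walk v v), p.IsCycle := by
  classical
  by_contra hcon
  push Not at hcon
  have hac : G.IsAcyclic := fun v p => hcon v p
  obtain ⟨e, he⟩ := hne
  induction e with | _ a b
  have : Nonempty V := ⟨a⟩
  have : Finite G.edgeSet := hfin
  obtain ⟨u, v, p, hp, hmax⟩ := SimpleGraph.Walk.exists_isPath_forall_isPath_length_le_length G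
  have hab : G.Adj a b := he
  have hnil : ¬ p.Nil := by
    intro h
    have h1 := hmax a b (SimpleGraph.Walk.cons hab .nil) (by simp [hab.ne])
    have h2 := SimpleGraph.Walk.length_eq_zero_iff.mpr h
    simp [h2] at h1
  obtain ⟨w, hw, hadj⟩ := hleaf _ _ (p.adj_snd hnil)
  apply hw
  apply hac.eq_snd_of_adj_start hp hadj
  by_contra hws
  have := hmax _ _ (p.cons hadj.symm) (hp.cons hws)
  simp at this

/-! ### From reachability of squares to interior and exterior in the plane -/

section Topology

/-- The closed unit square with centre `z`. -/
def closedSquare (z : Square) : Set (ℝ × ℝ) :=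
  {p | |p.1 - (z.1 : ℝ)| ≤ 1 / 2 ∧ |p.2 - (z.2 : ℝ)| ≤ 1 / 2}

/-- The centre of the square `z`. -/
def center (z : Square) : ℝ × ℝ := ((z.1 : ℝ), (z.2 : ℝ))

theorem center_mem_openSquare (z : Square) : center z ∈ openSquare z := by
  simp [center, openSquare]

theorem openSquare_subset_closedSquare (z : Square) : openSquare z ⊆ closedSquare z :=
  fun _ h => ⟨h.1.le, h.2.le⟩

theorem isClosed_closedSquare (z : Square) : IsClosed (closedSquare z) := by
  have h1 : IsClosed {p : ℝ × ℝ | |p.1 - (z.1 : ℝ)| ≤ 1 / 2} :=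
    isClosed_le (by fun_prop) (by fun_prop)
  have h2 : IsClosed {p : ℝ × ℝ | |p.2 - (z.2 : ℝ)| ≤ 1 / 2} :=
    isClosed_le (by fun_prop) (by fun_prop)
  exact h1.inter h2

theorem closedSquare_subset_closedBall (z : Square) :
    closedSquare z ⊆ Metric.closedBall (center z) 1 := by
  intro p hp
  rw [Metric.mem_closedBall, Prod.dist_eq, max_le_iff, Real.dist_eq, Real.dist_eq]
  exact ⟨hp.1.trans (by norm_num), hp.2.trans (by norm_num)⟩

theorem isBounded_closedSquare (z : Square) : Bornology.IsBounded (closedSquare z) :=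
  Metric.isBounded_closedBall.subset (closedSquare_subset_closedBall z)

theorem convex_openSquare (z : Square) : Convex ℝ (openSquare z) := by
  have : openSquare z = Metric.ball (center z) (1 / 2) := by
    ext p
    simp [openSquare, center, Prod.dist_eq, Real.dist_eq]
  rw [this]
  exact convex_ball _ _

theorem exists_mem_closedSquare (p : ℝ × ℝ) : ∃ z, p ∈ closedSquare z :=
  ⟨(round p.1, round p.2), abs_sub_round p.1, abs_sub_round p.2⟩

/-- Needed to make `region A` closed for infinite `A` too, in particular for complements of finite
sets. -/
theorem locallyFinite_closedSquare : LocallyFinite closedSquare := by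
  intro p
  refine ⟨Metric.ball p 1, Metric.ball_mem_nhds p one_pos, ?_⟩
  refine (Set.finite_Icc ((⌊p.1⌋ - 3, ⌊p.2⌋ - 3) : ℤ × ℤ) (⌊p.1⌋ + 3, ⌊p.2⌋ + 3)).subset ?_
  rintro z ⟨q, hq, hqp⟩
  rw [Metric.mem_ball, Prod.dist_eq, max_lt_iff, Real.dist_eq, Real.dist_eq] at hqp
  obtain ⟨h1, h2⟩ := hq
  rw [abs_le] at h1 h2
  rw [abs_lt, abs_lt] at hqp
  have a1 := Int.floor_le p.1
  have a2 := Int.lt_floor_add_one p.1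
  have b1 := Int.floor_le p.2
  have b2 := Int.lt_floor_add_one p.2
  refine ⟨⟨?_, ?_⟩, ⟨?_, ?_⟩⟩ <;> rw [← Int.cast_le (R := ℝ)] <;> push_cast <;> linarith

/-- The region covered by the closed squares in `A`. -/
def region (A : Set Square) : Set (ℝ × ℝ) := ⋃ z : A, closedSquare z

theorem mem_region {A : Set Square} {p : ℝ × ℝ} :
    p ∈ region A ↔ ∃ z ∈ A, p ∈ closedSquare z := by
  simp [region]

theorem isClosed_region (A : Set Square) : IsClosed (region A) :=
  (locallyFinite_closedSquare.comp_injective Subtype.val_injective).isClosed_iUnion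
    fun z => isClosed_closedSquare z

theorem isBounded_region {A : Set Square} (hA : A.Finite) : Bornology.IsBounded (region A) := by
  have := hA.to_subtype
  rw [region, Bornology.isBounded_iUnion]
  exact fun z => isBounded_closedSquare z

theorem mem_segment_hEdge {v : Corner} {p : ℝ × ℝ} :
    p ∈ segment ℝ (cornerPoint v) (cornerPoint (v.1 + 1, v.2)) ↔
      p.2 = v.2 - 1 / 2 ∧ |p.1 - v.1| ≤ 1 / 2 := by
  rw [segment_eq_image_lineMap, abs_le]
  simp only [Set.mem_image, AffineMap.lineMap_apply, cornerPoint, Prod.ext_iff, Set.mem_Icc]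
  simp only [vsub_eq_sub, Prod.mk_sub_mk, Prod.smul_mk, vadd_eq_add, Prod.mk_add_mk, smul_eq_mul]
  push_cast
  constructor
  · rintro ⟨t, ⟨h0, h1⟩, h2, h3⟩
    exact ⟨by linarith, by linarith, by linarith⟩
  · rintro ⟨h1, h2, h3⟩
    exact ⟨p.1 - v.1 + 1 / 2, ⟨by linarith, by linarith⟩, by ring, by rw [h1]; ring⟩

theorem mem_segment_vEdge {v : Corner} {p : ℝ × ℝ} :
    p ∈ segment ℝ (cornerPoint v) (cornerPoint (v.1, v.2 + 1)) ↔
      p.1 = v.1 - 1 / 2 ∧ |p.2 - v.2| ≤ 1 / 2 := by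
  rw [segment_eq_image_lineMap, abs_le]
  simp only [Set.mem_image, AffineMap.lineMap_apply, cornerPoint, Prod.ext_iff, Set.mem_Icc]
  simp only [vsub_eq_sub, Prod.mk_sub_mk, Prod.smul_mk, vadd_eq_add, Prod.mk_add_mk, smul_eq_mul]
  push_cast
  constructor
  · rintro ⟨t, ⟨h0, h1⟩, h2, h3⟩
    exact ⟨by linarith, by linarith, by linarith⟩
  · rintro ⟨h1, h2, h3⟩
    exact ⟨p.2 - v.2 + 1 / 2, ⟨by linarith, by linarith⟩, by rw [h1]; ring, by ring⟩

theorem mem_carrier_of_hEdge {C : Set (Sym2 Corner)} {v : Corner} {p : ℝ × ℝ} (hv : hEdge v ∈ C)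
    (h1 : p.2 = v.2 - 1 / 2) (h2 : |p.1 - v.1| ≤ 1 / 2) : p ∈ carrier C :=
  ⟨_, _, hv, mem_segment_hEdge.mpr ⟨h1, h2⟩⟩

theorem mem_carrier_of_vEdge {C : Set (Sym2 Corner)} {v : Corner} {p : ℝ × ℝ} (hv : vEdge v ∈ C)
    (h1 : p.1 = v.1 - 1 / 2) (h2 : |p.2 - v.2| ≤ 1 / 2) : p ∈ carrier C :=
  ⟨_, _, hv, mem_segment_vEdge.mpr ⟨h1, h2⟩⟩

theorem exists_edge_of_mem_carrier {K : Set Square} {C : Set (Sym2 Corner)} (hC : C ⊆ edgesOf K)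
    {p : ℝ × ℝ} (hp : p ∈ carrier C) :
    ∃ v, (hEdge v ∈ C ∧ p.2 = v.2 - 1 / 2 ∧ |p.1 - v.1| ≤ 1 / 2) ∨
      (vEdge v ∈ C ∧ p.1 = v.1 - 1 / 2 ∧ |p.2 - v.2| ≤ 1 / 2) := by
  obtain ⟨a, b, hab, hp⟩ := hp
  obtain ⟨z, _, hz⟩ := hC hab
  obtain ⟨v, hv | hv⟩ := eq_hEdge_or_eq_vEdge hz
  · refine ⟨v, .inl ⟨hv ▸ hab, mem_segment_hEdge.mp ?_⟩⟩
    rw [hEdge, Sym2.eq_iff] at hv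
    rcases hv with ⟨rfl, rfl⟩ | ⟨rfl, rfl⟩
    exacts [hp, by rwa [segment_symm]]
  · refine ⟨v, .inr ⟨hv ▸ hab, mem_segment_vEdge.mp ?_⟩⟩
    rw [vEdge, Sym2.eq_iff] at hv
    rcases hv with ⟨rfl, rfl⟩ | ⟨rfl, rfl⟩
    exacts [hp, by rwa [segment_symm]]

theorem ne_half_of_abs_lt {x : ℝ} {m n : ℤ} (h : |x - m| < 1 / 2) : x ≠ n - 1 / 2 := by
  rintro rfl
  rw [abs_lt] at h
  have h1 : (m : ℝ) < n := by linarith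
  have h2 : (n : ℝ) < m + 1 := by linarith
  norm_cast at h1 h2
  omega

theorem openSquare_disjoint_carrier {K : Set Square} {C : Set (Sym2 Corner)} (hC : C ⊆ edgesOf K)
    {z : Square} {p : ℝ × ℝ} (hp : p ∈ openSquare z) : p ∉ carrier C := by
  intro h
  obtain ⟨v, ⟨_, h, _⟩ | ⟨_, h, _⟩⟩ := exists_edge_of_mem_carrier hC h
  · exact ne_half_of_abs_lt hp.2 h
  · exact ne_half_of_abs_lt hp.1 h

/-- A set of squares that can only be left through edges of `C`. -/
def ClosedUpTo (C : Set (Sym2 Corner)) (A : Set Square) : Prop :=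
  ∀ a ∈ A, ∀ b ∉ A, ∀ e ∈ squareEdges a, e ∈ squareEdges b → e ∈ C

theorem eq_add_one_or_of_abs_le {x : ℝ} {m n : ℤ} (hm : |x - m| ≤ 1 / 2) (hn : |x - n| ≤ 1 / 2)
    (hmn : m ≠ n) : (m = n - 1 ∧ x = n - 1 / 2) ∨ (n = m - 1 ∧ x = m - 1 / 2) := by
  rw [abs_le] at hm hn
  have h1 : (m : ℝ) ≤ n + 1 := by linarith
  have h2 : (n : ℝ) ≤ m + 1 := by linarith
  norm_cast at h1 h2
  rcases lt_or_gt_of_ne hmn with h | h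
  · obtain rfl : n = m + 1 := by omega
    push_cast at *
    exact .inl ⟨by omega, by linarith⟩
  · obtain rfl : m = n + 1 := by omega
    push_cast at *
    exact .inr ⟨by omega, by linarith⟩

theorem exists_common_edge_of_column {x y y' : ℤ} (h : y ≠ y') {p : ℝ × ℝ}
    (h1 : p ∈ closedSquare (x, y)) (h2 : p ∈ closedSquare (x, y')) :
    ∃ e ∈ squareEdges (x, y), e ∈ squareEdges (x, y') ∧
      ∀ C : Set (Sym2 Corner), e ∈ C → p ∈ carrier C := by
  rcases eq_add_one_or_of_abs_le h1.2 h2.2 h with ⟨ha, hb⟩ | ⟨ha, hb⟩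
  · exact ⟨hEdge (x, y'), hEdge_mem_squareEdges.mpr (by simp; omega),
      hEdge_mem_squareEdges.mpr (by simp), fun C hC => mem_carrier_of_hEdge hC hb h1.1⟩
  · exact ⟨hEdge (x, y), hEdge_mem_squareEdges.mpr (by simp),
      hEdge_mem_squareEdges.mpr (by simp; omega), fun C hC => mem_carrier_of_hEdge hC hb h1.1⟩

theorem exists_common_edge_of_row {x x' y : ℤ} (h : x ≠ x') {p : ℝ × ℝ}
    (h1 : p ∈ closedSquare (x, y)) (h2 : p ∈ closedSquare (x', y)) :
    ∃ e ∈ squareEdges (x, y), e ∈ squareEdges (x', y) ∧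
      ∀ C : Set (Sym2 Corner), e ∈ C → p ∈ carrier C := by
  rcases eq_add_one_or_of_abs_le h1.1 h2.1 h with ⟨ha, hb⟩ | ⟨ha, hb⟩
  · exact ⟨vEdge (x', y), vEdge_mem_squareEdges.mpr (by simp; omega),
      vEdge_mem_squareEdges.mpr (by simp), fun C hC => mem_carrier_of_vEdge hC hb h1.2⟩
  · exact ⟨vEdge (x, y), vEdge_mem_squareEdges.mpr (by simp),
      vEdge_mem_squareEdges.mpr (by simp; omega), fun C hC => mem_carrier_of_vEdge hC hb h1.2⟩

/-- Two closed squares may meet in a corner only. The square in the column of one and the row of the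
other also contains the point, and passing through it leaves `A` across an edge through the point.
-/
theorem ClosedUpTo.region_inter_region_compl {C : Set (Sym2 Corner)} {A : Set Square}
    (hA : ClosedUpTo C A) : region A ∩ region Aᶜ ⊆ carrier C := by
  rintro p ⟨hp, hp'⟩
  obtain ⟨⟨x, y⟩, hz, hpz⟩ := mem_region.mp hp
  obtain ⟨⟨x', y'⟩, hw, hpw⟩ := mem_region.mp hp'
  have hpm : p ∈ closedSquare (x', y) := ⟨hpw.1, hpz.2⟩
  by_cases hm : ((x', y) : ℤ × ℤ) ∈ A
  · obtain ⟨e, h1, h2, h3⟩ := exists_common_edge_of_column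
      (by rintro rfl; exact hw hm) hpm hpw
    exact h3 C (hA _ hm _ hw e h1 h2)
  · obtain ⟨e, h1, h2, h3⟩ := exists_common_edge_of_row
      (by rintro rfl; exact hm hz) hpz hpm
    exact h3 C (hA _ hz _ hm e h1 h2)

/-- The closed sets `region A` and `region Aᶜ` cover the plane and meet only on the carrier, so no
connected set off the carrier meets both. -/
theorem ClosedUpTo.connectedComponentIn_subset_region {C : Set (Sym2 Corner)} {A : Set Square}
    (hA : ClosedUpTo C A) {p : ℝ × ℝ} (hp : p ∈ region A) :
    connectedComponentIn (carrier C)ᶜ p ⊆ region A := by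
  by_cases hpC : p ∈ (carrier C)ᶜ
  swap
  · rw [connectedComponentIn_eq_empty hpC]
    exact Set.empty_subset _
  have hcover : ∀ q, q ∈ region A ∨ q ∈ region Aᶜ := fun q => by
    obtain ⟨z, hz⟩ := exists_mem_closedSquare q
    by_cases h : z ∈ A
    · exact .inl (mem_region.mpr ⟨z, h, hz⟩)
    · exact .inr (mem_region.mpr ⟨z, h, hz⟩)
  intro q hq
  by_contra hqA
  obtain ⟨r, hr, hr'⟩ := isPreconnected_closed_iff.mp
    (isPreconnected_connectedComponentIn (F := (carrier C)ᶜ) (x := p))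
    (region A) (region Aᶜ) (isClosed_region A) (isClosed_region Aᶜ) (fun q _ => hcover q)
    ⟨p, mem_connectedComponentIn hpC, hp⟩ ⟨q, hq, (hcover q).resolve_left hqA⟩
  exact (connectedComponentIn_subset (carrier C)ᶜ p hr : r ∉ carrier C) (hA.region_inter_region_compl hr')

/-- The squares of a finite set that can only be left through edges of `C` lie in the interior
of `C`. -/
theorem ClosedUpTo.openSquare_subset_cycleInterior {K : Set Square} {C : Set (Sym2 Corner)}
    (hC : C ⊆ edgesOf K) {A : Set Square} (hA : ClosedUpTo C A) (hfin : A.Finite) {z : Square}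
    (hz : z ∈ A) : openSquare z ⊆ cycleInterior C := fun _ hp =>
  ⟨openSquare_disjoint_carrier hC hp, (isBounded_region hfin).subset
    (hA.connectedComponentIn_subset_region
      (mem_region.mpr ⟨z, hz, openSquare_subset_closedSquare z hp⟩))⟩

/-- The squares `a` and `b` share an edge that is not in `C`. -/
def ShareEdgeOff (C : Set (Sym2 Corner)) (a b : Square) : Prop :=
  ∃ e, e ∈ squareEdges a ∧ e ∈ squareEdges b ∧ e ∉ C

theorem ShareEdgeOff.symm {C : Set (Sym2 Corner)} {a b : Square} (h : ShareEdgeOff C a b) :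
    ShareEdgeOff C b a := by
  obtain ⟨e, h1, h2, h3⟩ := h
  exact ⟨e, h2, h1, h3⟩

theorem ShareEdgeOff.mono {C D : Set (Sym2 Corner)} (hCD : C ⊆ D) {a b : Square}
    (h : ShareEdgeOff D a b) : ShareEdgeOff C a b := by
  obtain ⟨e, h1, h2, h3⟩ := h
  exact ⟨e, h1, h2, fun h => h3 (hCD h)⟩

/-- The square `b` can be reached from `a` without crossing an edge of `C`. -/
def ReachableOff (C : Set (Sym2 Corner)) : Square → Square → Prop :=
  Relation.ReflTransGen (ShareEdgeOff C)

theorem ReachableOff.symm {C : Set (Sym2 Corner)} {a b : Square} (h : ReachableOff C a b) :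
    ReachableOff C b a :=
  have : Std.Symm (ShareEdgeOff C) := ⟨fun _ _ h => h.symm⟩
  Relation.ReflTransGen.stdSymm.symm _ _ h

theorem ReachableOff.mono {C D : Set (Sym2 Corner)} (hCD : C ⊆ D) {a b : Square}
    (h : ReachableOff D a b) : ReachableOff C a b :=
  Relation.ReflTransGen.mono (fun _ _ h => ShareEdgeOff.mono hCD h) _ _ h

theorem closedUpTo_reachableOff (C : Set (Sym2 Corner)) (a : Square) :
    ClosedUpTo C {b | ReachableOff C a b} := by
  intro b hb c hc e he he'
  by_contra heC
  exact hc (hb.tail ⟨e, he, he', heC⟩)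

theorem eq_of_abs_sub_half_le {m n : ℤ} (h : |(m : ℝ) - n| ≤ 1 / 2) : m = n := by
  rw [abs_le] at h
  have h1 : (m : ℝ) < n + 1 := by linarith
  have h2 : (n : ℝ) < m + 1 := by linarith
  norm_cast at h1 h2
  omega

theorem int_ne_sub_half (m n : ℤ) : (m : ℝ) ≠ n - 1 / 2 :=
  ne_half_of_abs_lt (m := m) (by simp)

/-- The segment between the two centres meets the lines of the tiling only at the midpoint of the
common edge. -/
theorem disjoint_segment_of_vEdge_notMem {K : Set Square} {C : Set (Sym2 Corner)}
    (hC : C ⊆ edgesOf K) {v : Square} (hv : vEdge v ∉ C) :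
    segment ℝ (center (v.1 - 1, v.2)) (center v) ⊆ (carrier C)ᶜ := by
  rw [segment_eq_image_lineMap]
  rintro _ ⟨t, ⟨h0, h1⟩, rfl⟩ hmem
  simp only [AffineMap.lineMap_apply, center, vsub_eq_sub, Prod.mk_sub_mk, Prod.smul_mk,
    vadd_eq_add, Prod.mk_add_mk, smul_eq_mul, sub_self, mul_zero, zero_add] at hmem
  obtain ⟨w, ⟨-, h, -⟩ | ⟨hw, h, h'⟩⟩ := exists_edge_of_mem_carrier hC hmem
  · exact int_ne_sub_half _ _ h
  · have e2 := eq_of_abs_sub_half_le h'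
    push_cast at h
    have a1 : (v.1 : ℝ) - 1 < w.1 := by linarith
    have a2 : (w.1 : ℝ) < v.1 + 1 := by linarith
    norm_cast at a1 a2
    have e1 : v.1 = w.1 := by omega
    rw [show v = w from Prod.ext e1 e2] at hv
    exact hv hw

theorem disjoint_segment_of_hEdge_notMem {K : Set Square} {C : Set (Sym2 Corner)}
    (hC : C ⊆ edgesOf K) {v : Square} (hv : hEdge v ∉ C) :
    segment ℝ (center (v.1, v.2 - 1)) (center v) ⊆ (carrier C)ᶜ := by
  rw [segment_eq_image_lineMap]
  rintro _ ⟨t, ⟨h0, h1⟩, rfl⟩ hmem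
  simp only [AffineMap.lineMap_apply, center, vsub_eq_sub, Prod.mk_sub_mk, Prod.smul_mk,
    vadd_eq_add, Prod.mk_add_mk, smul_eq_mul, sub_self, mul_zero, zero_add] at hmem
  obtain ⟨w, ⟨hw, h, h'⟩ | ⟨-, h, -⟩⟩ := exists_edge_of_mem_carrier hC hmem
  · have e1 := eq_of_abs_sub_half_le h'
    push_cast at h
    have a1 : (v.2 : ℝ) - 1 < w.2 := by linarith
    have a2 : (w.2 : ℝ) < v.2 + 1 := by linarith
    norm_cast at a1 a2
    have e2 : v.2 = w.2 := by omega
    rw [show v = w from Prod.ext e1 e2] at hv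
    exact hv hw
  · exact int_ne_sub_half _ _ h

theorem ShareEdgeOff.segment_subset {K : Set Square} {C : Set (Sym2 Corner)} (hC : C ⊆ edgesOf K)
    {a b : Square} (h : ShareEdgeOff C a b) :
    segment ℝ (center a) (center b) ⊆ (carrier C)ᶜ := by
  have hself : ∀ z, segment ℝ (center z) (center z) ⊆ (carrier C)ᶜ := fun z => by
    rw [segment_same, Set.singleton_subset_iff]
    exact openSquare_disjoint_carrier hC (center_mem_openSquare z)
  obtain ⟨e, ha, hb, heC⟩ := h
  obtain ⟨v, rfl | rfl⟩ := eq_hEdge_or_eq_vEdge ha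
  · have := disjoint_segment_of_hEdge_notMem hC heC
    rw [hEdge_mem_squareEdges] at ha hb
    rcases ha with rfl | rfl <;> rcases hb with rfl | rfl
    exacts [hself _, by rwa [segment_symm], this, hself _]
  · have := disjoint_segment_of_vEdge_notMem hC heC
    rw [vEdge_mem_squareEdges] at ha hb
    rcases ha with rfl | rfl <;> rcases hb with rfl | rfl
    exacts [hself _, by rwa [segment_symm], this, hself _]

theorem ReachableOff.center_mem {K : Set Square} {C : Set (Sym2 Corner)} (hC : C ⊆ edgesOf K)
    {a b : Square} (h : ReachableOff C a b) :
    center b ∈ connectedComponentIn (carrier C)ᶜ (center a) := by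
  induction h with
  | refl =>
    exact mem_connectedComponentIn (openSquare_disjoint_carrier hC (center_mem_openSquare a))
  | tail _ hbc ih =>
    rw [connectedComponentIn_eq ih]
    exact (convex_segment _ _).isPreconnected.subset_connectedComponentIn
      (left_mem_segment ℝ _ _) (hbc.segment_subset hC) (right_mem_segment ℝ _ _)

theorem finite_of_isBounded_center {A : Set Square} (h : Bornology.IsBounded (center '' A)) :
    A.Finite := by
  obtain ⟨r, hr⟩ := h.subset_closedBall 0
  refine (Set.finite_Icc ((-⌈r⌉, -⌈r⌉) : ℤ × ℤ) (⌈r⌉, ⌈r⌉)).subset fun z hz => ?_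
  have := hr ⟨z, hz, rfl⟩
  rw [Metric.mem_closedBall, Prod.dist_eq, max_le_iff, Real.dist_eq, Real.dist_eq] at this
  simp only [center, Prod.fst_zero, Prod.snd_zero, sub_zero, abs_le] at this
  have h1 := Int.le_ceil r
  refine ⟨⟨?_, ?_⟩, ⟨?_, ?_⟩⟩ <;> rw [← Int.cast_le (R := ℝ)] <;> push_cast <;> linarith

/-- A square from which infinitely many squares can be reached lies in the exterior. -/
theorem openSquare_subset_cycleExterior {K : Set Square} {C : Set (Sym2 Corner)}
    (hC : C ⊆ edgesOf K) {a : Square} (h : {b | ReachableOff C a b}.Infinite) :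
    openSquare a ⊆ cycleExterior C := by
  intro p hp
  refine ⟨openSquare_disjoint_carrier hC hp, fun hb => h (finite_of_isBounded_center ?_)⟩
  have hpa : center a ∈ connectedComponentIn (carrier C)ᶜ p :=
    (convex_openSquare a).isPreconnected.subset_connectedComponentIn hp
      (fun _ => openSquare_disjoint_carrier hC) (center_mem_openSquare a)
  rw [connectedComponentIn_eq hpa] at hb
  refine hb.subset ?_
  rintro _ ⟨b, hab, rfl⟩
  exact hab.center_mem hC

theorem infinite_of_openSquare_subset_cycleExterior {K : Set Square} {C : Set (Sym2 Corner)}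
    (hC : C ⊆ edgesOf K) {a : Square} (h : openSquare a ⊆ cycleExterior C) :
    {b | ReachableOff C a b}.Infinite := fun hfin =>
  (h (center_mem_openSquare a)).2 ((closedUpTo_reachableOff C a).openSquare_subset_cycleInterior
    hC hfin Relation.ReflTransGen.refl (center_mem_openSquare a)).2

end Topology

/-! ### The outer boundary of a finite set of squares -/

section OuterBoundary

variable {K : Set Square}

/-- The squares from which infinitely many squares can be reached avoiding `K`. -/
def outerSquares (K : Set Square) : Set Square := {a | {b | ReachableOff (edgesOf K) a b}.Infinite}

/-- The edges between an outer square and a square that is not outer. -/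
def outerBoundary (K : Set Square) : Set (Sym2 Corner) :=
  {e | ∃ a ∉ outerSquares K, ∃ b ∈ outerSquares K, e ∈ squareEdges a ∧ e ∈ squareEdges b}

theorem shareEdgeOff_of_notMem {a b : Square} {e : Sym2 Corner} (hab : a ≠ b) (ha : a ∉ K)
    (hb : b ∉ K) (hea : e ∈ squareEdges a) (heb : e ∈ squareEdges b) :
    ShareEdgeOff (edgesOf K) a b := by
  refine ⟨e, hea, heb, ?_⟩
  rintro ⟨c, hc, hec⟩
  rcases eq_or_eq_of_mem_squareEdges hea heb hab hec with rfl | rfl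
  exacts [ha hc, hb hc]

/-- All edges of a square of `K` are barred, so it reaches only itself. -/
theorem notMem_outerSquares_of_mem {a : Square} (ha : a ∈ K) : a ∉ outerSquares K := by
  refine fun h => h ((Set.finite_singleton a).subset fun b hb => ?_)
  rcases Relation.ReflTransGen.cases_head hb with h | ⟨c, ⟨e, he, -, heK⟩, -⟩
  · exact h.symm
  · exact absurd ⟨a, ha, he⟩ heK

theorem ReachableOff.mem_outerSquares {a b : Square} (h : ReachableOff (edgesOf K) a b)
    (hb : b ∈ outerSquares K) : a ∈ outerSquares K :=
  Set.Infinite.mono (fun _ hc => Relation.ReflTransGen.trans h hc) hb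

theorem mem_of_notMem_outerSquares {a b : Square} {e : Sym2 Corner} (ha : a ∉ outerSquares K)
    (hb : b ∈ outerSquares K) (hea : e ∈ squareEdges a) (heb : e ∈ squareEdges b) : a ∈ K := by
  by_contra haK
  have hbK : b ∉ K := fun h => notMem_outerSquares_of_mem h hb
  have hab : a ≠ b := by
    rintro rfl
    exact ha hb
  exact ha (ReachableOff.mem_outerSquares
    (.single (shareEdgeOff_of_notMem hab haK hbK hea heb)) hb)

theorem outerBoundary_subset_edgesOf : outerBoundary K ⊆ edgesOf K := fun _ ⟨a, ha, _, hb, h⟩ =>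
  ⟨a, mem_of_notMem_outerSquares ha hb h.1 h.2, h.1⟩

theorem reachableOff_of_row {y : ℤ} (h : ∀ i : ℤ, (i, y) ∉ K) (x x' : ℤ) :
    ReachableOff (edgesOf K) (x, y) (x', y) := by
  wlog hx : x ≤ x' generalizing x x'
  · exact (this x' x (by omega)).symm
  induction x', hx using Int.leInduction with
  | base => exact .refl
  | succ n _ ih =>
    exact ih.tail (shareEdgeOff_of_notMem (e := vEdge (n + 1, y)) (by simp) (h _) (h _)
      (vEdge_mem_squareEdges.mpr (by simp)) (vEdge_mem_squareEdges.mpr (by simp)))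

theorem reachableOff_of_column {x : ℤ} (h : ∀ j : ℤ, (x, j) ∉ K) (y y' : ℤ) :
    ReachableOff (edgesOf K) (x, y) (x, y') := by
  wlog hy : y ≤ y' generalizing y y'
  · exact (this y' y (by omega)).symm
  induction y', hy using Int.leInduction with
  | base => exact .refl
  | succ n _ ih =>
    exact ih.tail (shareEdgeOff_of_notMem (e := hEdge (x, n + 1)) (by simp) (h _) (h _)
      (hEdge_mem_squareEdges.mpr (by simp)) (hEdge_mem_squareEdges.mpr (by simp)))

/-- All squares outside a box around `K` can be reached from one another avoiding `K`. -/
theorem exists_box (hK : K.Finite) : ∃ (B : Set Square) (o : Square), B.Finite ∧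
    ∀ z ∉ B, ReachableOff (edgesOf K) z o := by
  obtain ⟨⟨p, q⟩, hi⟩ := hK.bddAbove
  obtain ⟨⟨r, s⟩, lo⟩ := hK.bddBelow
  have hK' : ∀ x y : ℤ, (x, y) ∈ K → r ≤ x ∧ x ≤ p ∧ s ≤ y ∧ y ≤ q := fun x y h =>
    ⟨(lo h).1, (hi h).1, (lo h).2, (hi h).2⟩
  have hcol : ∀ x, ¬ (r ≤ x ∧ x ≤ p) → ∀ j : ℤ, (x, j) ∉ K := fun x hx j h => by
    have := hK' _ _ h
    omega
  have hrow : ∀ y, ¬ (s ≤ y ∧ y ≤ q) → ∀ i : ℤ, (i, y) ∉ K := fun y hy i h => by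
    have := hK' _ _ h
    omega
  -- Column `p + 1` and row `q + 1` miss `K`, and every square outside the box has a row or a column
  -- missing `K` that leads to one of them.
  refine ⟨Set.Icc (r, s) (p, q), (p + 1, q + 1), Set.finite_Icc _ _, ?_⟩
  rintro ⟨x, y⟩ hz
  by_cases hx : r ≤ x ∧ x ≤ p
  · have hy : ¬ (s ≤ y ∧ y ≤ q) := fun hy => hz ⟨⟨hx.1, hy.1⟩, ⟨hx.2, hy.2⟩⟩
    exact (reachableOff_of_row (hrow y hy) x (p + 1)).trans
      (reachableOff_of_column (hcol (p + 1) (by omega)) y (q + 1))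
  · exact (reachableOff_of_column (hcol x hx) y (q + 1)).trans
      (reachableOff_of_row (hrow (q + 1) (by omega)) x (p + 1))

theorem finite_compl_outerSquares (hK : K.Finite) : (outerSquares K)ᶜ.Finite := by
  obtain ⟨B, o, hB, h⟩ := exists_box hK
  refine hB.subset fun z hz => ?_
  by_contra hzB
  refine hz (Set.Infinite.mono (fun w hw => ?_) hB.infinite_compl)
  exact (h z hzB).trans (h w hw).symm

theorem reachableOff_of_mem_outerSquares (hK : K.Finite) {a b : Square}
    (ha : a ∈ outerSquares K) (hb : b ∈ outerSquares K) : ReachableOff (edgesOf K) a b := by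
  obtain ⟨B, o, hB, h⟩ := exists_box hK
  have key : ∀ c ∈ outerSquares K, ReachableOff (edgesOf K) c o := by
    intro c hc
    obtain ⟨d, hd, hdB⟩ := hc.exists_notMem_finite hB
    exact Relation.ReflTransGen.trans hd (h d hdB)
  exact (key a ha).trans (key b hb).symm

theorem closedUpTo_outerBoundary : ClosedUpTo (outerBoundary K) (outerSquares K)ᶜ :=
  fun a ha b hb _ hea heb => ⟨a, ha, b, not_not.mp hb, hea, heb⟩

/-- Otherwise no square to the right of `o` in its row would be outer, giving infinitely many
non-outer squares. -/
theorem outerBoundary_nonempty (hK : K.Finite) {o : Square} (ho : o ∈ K) :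
    (outerBoundary K).Nonempty := by
  by_contra hne
  rw [Set.not_nonempty_iff_eq_empty] at hne
  have key : ∀ n : ℕ, (o.1 + n, o.2) ∉ outerSquares K := by
    intro n
    induction n with
    | zero => simpa using notMem_outerSquares_of_mem ho
    | succ n ih =>
      intro h
      have : vEdge (o.1 + n + 1, o.2) ∈ outerBoundary K :=
        ⟨_, ih, _, h, vEdge_mem_squareEdges.mpr (by simp),
          vEdge_mem_squareEdges.mpr (by simp [add_assoc])⟩
      simp [hne] at this
  refine Set.infinite_of_injective_forall_mem (f := fun n : ℕ => ((o.1 + n, o.2) : Square))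
    (fun m n h => ?_) key (finite_compl_outerSquares hK)
  simpa using h

theorem mem_outerBoundary_of_squares {e : Sym2 Corner} {a b : Square} (hab : a ≠ b)
    (ha : e ∈ squareEdges a) (hb : e ∈ squareEdges b) :
    e ∈ outerBoundary K ↔ ¬ (a ∈ outerSquares K ↔ b ∈ outerSquares K) := by
  constructor
  · rintro ⟨c, hc, d, hd, hec, hed⟩ hiff
    rcases eq_or_eq_of_mem_squareEdges ha hb hab hec with rfl | rfl <;>
      rcases eq_or_eq_of_mem_squareEdges ha hb hab hed with rfl | rfl <;> tauto
  · intro h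
    by_cases h1 : a ∈ outerSquares K
    · exact ⟨b, by tauto, a, h1, hb, ha⟩
    · exact ⟨a, h1, b, by tauto, ha, hb⟩

theorem hEdge_mem_outerBoundary {x y : ℤ} : hEdge (x, y) ∈ outerBoundary K ↔
    ¬ ((x, y) ∈ outerSquares K ↔ (x, y - 1) ∈ outerSquares K) :=
  mem_outerBoundary_of_squares (by simp; omega) (hEdge_mem_squareEdges.mpr (by simp))
    (hEdge_mem_squareEdges.mpr (by simp))

theorem vEdge_mem_outerBoundary {x y : ℤ} : vEdge (x, y) ∈ outerBoundary K ↔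
    ¬ ((x, y) ∈ outerSquares K ↔ (x - 1, y) ∈ outerSquares K) :=
  mem_outerBoundary_of_squares (by simp; omega) (vEdge_mem_squareEdges.mpr (by simp))
    (vEdge_mem_squareEdges.mpr (by simp))

/-- An edge at `u` is in the boundary when it separates outer from non-outer among the four squares
around `u`. If three edges do not separate, the chain of equivalences shows that the fourth does not
either. -/
theorem outerBoundary_no_leaf {u v : Corner} (h : s(u, v) ∈ outerBoundary K) :
    ∃ w, w ≠ v ∧ u ≠ w ∧ s(u, w) ∈ outerBoundary K := by
  obtain ⟨x, y⟩ := u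
  have hr : s((x, y), (x + 1, y)) ∈ outerBoundary K ↔ _ := hEdge_mem_outerBoundary (x := x)
  have hu : s((x, y), (x, y + 1)) ∈ outerBoundary K ↔ _ := vEdge_mem_outerBoundary (x := x)
  have hl : s((x, y), (x - 1, y)) ∈ outerBoundary K ↔
      ¬ ((x - 1, y) ∈ outerSquares K ↔ (x - 1, y - 1) ∈ outerSquares K) := by
    rw [Sym2.eq_swap]
    simpa only [hEdge, sub_add_cancel] using hEdge_mem_outerBoundary (K := K) (x := x - 1) (y := y)
  have hd : s((x, y), (x, y - 1)) ∈ outerBoundary K ↔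
      ¬ ((x, y - 1) ∈ outerSquares K ↔ (x - 1, y - 1) ∈ outerSquares K) := by
    rw [Sym2.eq_swap]
    simpa only [vEdge, sub_add_cancel] using vEdge_mem_outerBoundary (K := K) (x := x) (y := y - 1)
  have hv : v = (x + 1, y) ∨ v = (x - 1, y) ∨ v = (x, y + 1) ∨ v = (x, y - 1) := by
    obtain ⟨z, _, hz⟩ := outerBoundary_subset_edgesOf h
    obtain ⟨⟨a, b⟩, hv | hv⟩ := eq_hEdge_or_eq_vEdge hz
    · rw [hEdge, Sym2.eq_iff] at hv
      simp only [Prod.ext_iff] at hv ⊢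
      omega
    · rw [vEdge, Sym2.eq_iff] at hv
      simp only [Prod.ext_iff] at hv ⊢
      omega
  by_contra hcon
  have key : ∀ w, (x, y) ≠ w → s((x, y), w) ∈ outerBoundary K → w = v := fun w h1 h2 => by
    by_contra hne
    exact hcon ⟨w, hne, h1, h2⟩
  have c1 := fun h => key (x + 1, y) (by simp) (hr.mpr h)
  have c2 := fun h => key (x - 1, y) (by simp; omega) (hl.mpr h)
  have c3 := fun h => key (x, y + 1) (by simp) (hu.mpr h)
  have c4 := fun h => key (x, y - 1) (by simp; omega) (hd.mpr h)
  have e1 : x + 1 ≠ x - 1 := by omega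
  have e2 : y + 1 ≠ y - 1 := by omega
  rcases hv with rfl | rfl | rfl | rfl
  · rw [hr] at h
    simp only [Prod.mk.injEq, e1.symm, add_eq_left, sub_eq_self, left_eq_add, one_ne_zero,
      false_and, and_false, imp_false, not_not] at c2 c3 c4
    exact h (c3.trans (c2.trans c4.symm))
  · rw [hl] at h
    simp only [Prod.mk.injEq, e1, add_eq_left, sub_eq_self,
      one_ne_zero, false_and, and_false, imp_false, not_not] at c1 c3 c4
    exact h (c3.symm.trans (c1.trans c4))
  · rw [hu] at h
    simp only [Prod.mk.injEq, e2.symm, add_eq_left, sub_eq_self, left_eq_add, one_ne_zero,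
      and_false, imp_false, not_not] at c1 c2 c4
    exact h (c1.trans (c4.trans c2.symm))
  · rw [hd] at h
    simp only [Prod.mk.injEq, e2, add_eq_left, sub_eq_self, one_ne_zero,
      false_and, and_false, imp_false, not_not] at c1 c2 c3
    exact h (c1.symm.trans (c3.trans c2))

theorem finite_edgesOf (hK : K.Finite) : (edgesOf K).Finite := by
  have : edgesOf K = ⋃ z ∈ K, squareEdges z := by
    ext e
    simp [edgesOf]
  rw [this]
  exact hK.biUnion fun z _ => by
    unfold squareEdges
    exact Set.toFinite _

theorem exists_cycle_subset_outerBoundary (hK : K.Finite) {o : Square} (ho : o ∈ K) :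
    ∃ C, IsCycleIn (edgeGraph K) C ∧ C ⊆ outerBoundary K := by
  have hsub := outerBoundary_subset_edgesOf (K := K)
  let H := SimpleGraph.fromEdgeSet (outerBoundary K)
  have hHe : H.edgeSet = outerBoundary K := by
    rw [SimpleGraph.edgeSet_fromEdgeSet]
    ext e
    refine ⟨fun h => h.1, fun h => ⟨h, fun hd => ?_⟩⟩
    obtain ⟨z, _, hz⟩ := hsub h
    exact not_isDiag_of_mem_squareEdges hz hd
  have hH : H ≤ edgeGraph K := SimpleGraph.fromEdgeSet_mono hsub
  obtain ⟨v, p, hp⟩ := exists_isCycle_of_no_leaf (G := H)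
    (by rw [hHe]; exact (finite_edgesOf hK).subset hsub)
    (by rw [hHe]; exact outerBoundary_nonempty hK ho) (fun u v h => by
      obtain ⟨w, h1, h2, h3⟩ := outerBoundary_no_leaf ((SimpleGraph.fromEdgeSet_adj _).mp h).1
      exact ⟨w, h1, (SimpleGraph.fromEdgeSet_adj _).mpr ⟨h3, h2⟩⟩)
  refine ⟨_, ⟨v, p.mapLe hH, hp.mapLe hH, rfl⟩, fun e he => ?_⟩
  rw [Set.mem_ofPred_eq, SimpleGraph.Walk.edges_mapLe_eq_edges] at he
  rw [← hHe]
  exact p.edges_subset_edgeSet he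

theorem IsCycleIn.nonempty {H : SimpleGraph Corner} {C : Set (Sym2 Corner)}
    (h : IsCycleIn H C) : C.Nonempty := by
  obtain ⟨v, p, hp, rfl⟩ := h
  cases p with
  | nil => exact absurd rfl hp.ne_nil
  | cons h p => exact ⟨_, List.mem_cons_self⟩

/-- If `K` is connected, the outer boundary contains no other cycle than itself. -/
theorem eq_outerBoundary_of_subset (hK : K.Finite)
    (hconn : ∀ a ∈ K, ∀ b ∈ K, ReachableOff (outerBoundary K) a b) {C : Set (Sym2 Corner)}
    (hC : IsCycleIn (edgeGraph K) C) (hsub : C ⊆ outerBoundary K) : C = outerBoundary K := by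
  obtain ⟨f, hf⟩ := exists_colouring hC
  have hconst : ∀ a b, ReachableOff C a b → f a = f b := by
    intro a b h
    induction h with
    | refl => rfl
    | @tail b c _ hbc ih =>
      obtain ⟨e, h1, h2, h3⟩ := hbc
      rw [ih]
      by_contra hne
      exact h3 ((hf b c e (fun h => hne (h ▸ rfl)) h1 h2).mp hne)
  obtain ⟨e₀, he₀⟩ := hC.nonempty
  refine hsub.antisymm ?_
  rintro e ⟨a, ha, b, hb, hea, heb⟩
  obtain ⟨a₀, ha₀, b₀, hb₀, hea₀, heb₀⟩ := hsub he₀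
  have ha' := mem_of_notMem_outerSquares ha hb hea heb
  have ha₀' := mem_of_notMem_outerSquares ha₀ hb₀ hea₀ heb₀
  -- The inner squares of `e` and `e₀` have the same colour, and so do the outer ones, so the change
  -- of colour across `e₀` carries over to `e`.
  have h1 : f a = f a₀ := hconst _ _ ((hconn a ha' a₀ ha₀').mono hsub)
  have h2 : f b = f b₀ :=
    hconst _ _ ((reachableOff_of_mem_outerSquares hK hb hb₀).mono hC.subset_edgesOf)
  have h3 := (hf a₀ b₀ e₀ (fun h => ha₀ (h ▸ hb₀)) hea₀ heb₀).mpr he₀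
  refine (hf a b e (fun h => ha (h ▸ hb)) hea heb).mp ?_
  rwa [h1, h2]

theorem isCycleIn_outerBoundary (hK : K.Finite)
    (hconn : ∀ a ∈ K, ∀ b ∈ K, ReachableOff (outerBoundary K) a b) {o : Square} (ho : o ∈ K) :
    IsCycleIn (edgeGraph K) (outerBoundary K) := by
  obtain ⟨C, hC, hsub⟩ := exists_cycle_subset_outerBoundary hK ho
  rwa [eq_outerBoundary_of_subset hK hconn hC hsub] at hC

theorem containsSquares_outerBoundary (hK : K.Finite) : ContainsSquares K (outerBoundary K) :=
  fun _ hz => closedUpTo_outerBoundary.openSquare_subset_cycleInterior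
    outerBoundary_subset_edgesOf (finite_compl_outerSquares hK) (notMem_outerSquares_of_mem hz)

/-- The outer squares are in the exterior of every cycle of the graph of `K`. -/
theorem openSquare_subset_cycleExterior_of_mem_outerSquares {C : Set (Sym2 Corner)}
    (hC : C ⊆ edgesOf K) {a : Square} (ha : a ∈ outerSquares K) : openSquare a ⊆ cycleExterior C :=
  openSquare_subset_cycleExterior hC (Set.Infinite.mono (fun _ h => ReachableOff.mono hC h) ha)

theorem cycleInterior_disjoint_cycleExterior {C : Set (Sym2 Corner)} {a : Square}
    (h : openSquare a ⊆ cycleInterior C) (h' : openSquare a ⊆ cycleExterior C) : False :=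
  (h' (center_mem_openSquare a)).2 (h (center_mem_openSquare a)).2

/-- The outer boundary is itself a test cycle, and no square of `K` is exterior to it. Conversely,
if a cycle misses an edge `e` of the outer boundary, both squares at `e` reach the outer one, hence
infinitely many squares. -/
theorem outermostBoundary_eq_outerBoundary (hK : K.Finite)
    (hcyc : IsCycleIn (edgeGraph K) (outerBoundary K)) :
    outermostBoundary K = outerBoundary K := by
  ext e
  constructor
  · rintro ⟨he, h⟩
    refine (h _ hcyc).resolve_right fun hext => ?_
    rw [edgeSet_edgeGraph] at he
    obtain ⟨z, hz, hez⟩ := he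
    exact cycleInterior_disjoint_cycleExterior (containsSquares_outerBoundary hK z hz)
      (hext z hez)
  · intro he
    refine ⟨?_, fun C hC => or_iff_not_imp_left.mpr fun heC z hez => ?_⟩
    · rw [edgeSet_edgeGraph]
      exact outerBoundary_subset_edgesOf he
    · obtain ⟨a, ha, b, hb, hea, heb⟩ := he
      have hCK := hC.subset_edgesOf
      refine openSquare_subset_cycleExterior hCK
        (Set.Infinite.mono (fun c hc => ?_) hb)
      -- The case `z = b` is included, since `ShareEdgeOff` does not ask for distinct squares.
      exact Relation.ReflTransGen.head ⟨e, hez, heb, heC⟩ (ReachableOff.mono hCK hc)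

/-- The vacant squares that are exterior to a cycle around `K` are outer squares. -/
theorem mem_outerSquares_of_subset_cycleExterior {C : Set (Sym2 Corner)} (hC : C ⊆ edgesOf K)
    (hin : ContainsSquares K C) {w : Square} (hw : openSquare w ⊆ cycleExterior C) :
    w ∈ outerSquares K := by
  have hinf := infinite_of_openSquare_subset_cycleExterior hC hw
  -- Squares reached from `w` off `C` are exterior, so they avoid `K`. A step between two distinct
  -- such squares then crosses no edge of `K`.
  have hnot : ∀ b, ReachableOff C w b → b ∉ K := fun b hb hbK =>
    cycleInterior_disjoint_cycleExterior (hin b hbK) (openSquare_subset_cycleExterior hC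
      (Set.Infinite.mono (fun _ hc => Relation.ReflTransGen.trans hb.symm hc) hinf))
  refine Set.Infinite.mono (fun b hb => ?_) hinf
  induction hb with
  | refl => exact .refl
  | @tail b c hwb hbc ih =>
    by_cases h : b = c
    · exact h ▸ ih
    · have hc := hnot c (Relation.ReflTransGen.tail hwb hbc)
      obtain ⟨e, h1, h2, -⟩ := hbc
      exact Relation.ReflTransGen.tail ih (shareEdgeOff_of_notMem h (hnot b hwb) hc h1 h2)

end OuterBoundary

/-! ### The plus connected component of the origin -/

section Component

variable {occ : Set Square}

theorem mem_plusComponent_of_adj {a b : Square} (ha : a ∈ plusComponent occ)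
    (hab : plusGraph.Adj a b) (hb : b ∈ occ) : b ∈ plusComponent occ := by
  classical
  obtain ⟨p, -, hp⟩ := ha
  refine ⟨(p.concat hab).bypass, (p.concat hab).bypass_isPath, fun y hy => ?_⟩
  have := (p.concat hab).support_bypass_subset_support hy
  rw [SimpleGraph.Walk.support_concat, List.mem_append,
    List.mem_singleton] at this
  rcases this with h | rfl
  exacts [hp y h, hb]

/-- The walk stays in the component, which has no outer square, so none of its steps crosses the
outer boundary. -/
theorem reachableOff_of_walk {a b : Square} (p : plusGraph.Walk a b)
    (ha : a ∈ plusComponent occ) (hp : ∀ y ∈ p.support, y ∈ occ) :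
    ReachableOff (outerBoundary (plusComponent occ)) a b := by
  induction p with
  | nil => exact .refl
  | @cons u v w h p ih =>
    rw [SimpleGraph.Walk.support_cons, List.forall_mem_cons] at hp
    have hv := mem_plusComponent_of_adj ha h (hp.2 v p.start_mem_support)
    obtain ⟨hne, e, heu, hev⟩ := id h
    refine Relation.ReflTransGen.head ⟨e, heu, hev, ?_⟩ (ih hv hp.2)
    rintro ⟨c, -, d, hd, -, hed⟩
    rcases eq_or_eq_of_mem_squareEdges heu hev hne hed with rfl | rfl
    exacts [notMem_outerSquares_of_mem ha hd, notMem_outerSquares_of_mem hv hd]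

theorem origin_mem_plusComponent (h : ((0, 0) : Square) ∈ occ) : (0, 0) ∈ plusComponent occ :=
  ⟨.nil, .nil, by simpa using h⟩

theorem reachableOff_of_mem_plusComponent (h : ((0, 0) : Square) ∈ occ) {a b : Square}
    (ha : a ∈ plusComponent occ) (hb : b ∈ plusComponent occ) :
    ReachableOff (outerBoundary (plusComponent occ)) a b := by
  have key : ∀ c ∈ plusComponent occ,
      ReachableOff (outerBoundary (plusComponent occ)) (0, 0) c := by
    rintro c ⟨p, -, hp⟩
    exact reachableOff_of_walk p (origin_mem_plusComponent h) hp
  exact (key a ha).symm.trans (key b hb)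

theorem separatesOccupiedVacant_outerBoundary (h_finite : (plusComponent occ).Finite) :
    SeparatesOccupiedVacant occ (plusComponent occ) (outerBoundary (plusComponent occ)) := by
  rintro e ⟨a, ha, b, hb, hea, heb⟩
  have haK := mem_of_notMem_outerSquares ha hb hea heb
  refine ⟨⟨a, hea, haK, containsSquares_outerBoundary h_finite a haK⟩, b, heb, fun hbo => ?_,
    openSquare_subset_cycleExterior_of_mem_outerSquares outerBoundary_subset_edgesOf hb⟩
  -- If `b` were occupied, its adjacency to `a` would put it in the component, where no square is
  -- outer.
  exact notMem_outerSquares_of_mem (mem_plusComponent_of_adj haK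
    ⟨fun h => ha (h ▸ hb), e, hea, heb⟩ hbo) hb

end Component

end SquareTiling

theorem theorem2 (occ : Set SquareTiling.Square) (h_origin : ((0, 0) : ℤ × ℤ) ∈ occ)
    (h_finite : (SquareTiling.plusComponent occ).Finite) :
    (SquareTiling.IsCycleIn (SquareTiling.edgeGraph (SquareTiling.plusComponent occ))
        (SquareTiling.outermostBoundary (SquareTiling.plusComponent occ)) ∧
      SquareTiling.ContainsSquares (SquareTiling.plusComponent occ)
        (SquareTiling.outermostBoundary (SquareTiling.plusComponent occ)) ∧
      SquareTiling.SeparatesOccupiedVacant occ (SquareTiling.plusComponent occ)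
        (SquareTiling.outermostBoundary (SquareTiling.plusComponent occ))) ∧
    ∀ C : Set (Sym2 SquareTiling.Corner),
      SquareTiling.IsCycleIn (SquareTiling.edgeGraph (SquareTiling.plusComponent occ)) C →
      SquareTiling.ContainsSquares (SquareTiling.plusComponent occ) C →
      SquareTiling.SeparatesOccupiedVacant occ (SquareTiling.plusComponent occ) C →
      C = SquareTiling.outermostBoundary (SquareTiling.plusComponent occ) := by
  open SquareTiling in
  have hconn : ∀ a ∈ plusComponent occ, ∀ b ∈ plusComponent occ,
      ReachableOff (outerBoundary (plusComponent occ)) a b :=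
    fun _ ha _ hb => reachableOff_of_mem_plusComponent h_origin ha hb
  open SquareTiling in
  have hcyc := isCycleIn_outerBoundary h_finite hconn (origin_mem_plusComponent h_origin)
  rw [SquareTiling.outermostBoundary_eq_outerBoundary h_finite hcyc]
  refine ⟨⟨hcyc, SquareTiling.containsSquares_outerBoundary h_finite,
    SquareTiling.separatesOccupiedVacant_outerBoundary h_finite⟩, fun C hC hin hsep => ?_⟩
  -- It suffices that each edge of `C` joins a non-outer square to an outer one. By (ii) it has a
  -- square of the component and an exterior square, and by (i) the latter is outer.
  refine SquareTiling.eq_outerBoundary_of_subset h_finite hconn hC fun e he => ?_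
  obtain ⟨⟨z, hez, hz, -⟩, w, hew, -, hw⟩ := hsep e he
  exact ⟨z, SquareTiling.notMem_outerSquares_of_mem hz, w,
    SquareTiling.mem_outerSquares_of_subset_cycleExterior hC.subset_edgesOf hin hw, hez, hew⟩
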